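/- A \emph{clutter} $\mathcal{C}$ over a finite ground set $V$ is a family of subsets of $V$ (its \emph{members}), none of which contains another one. A \emph{cover} is a subset of $V$ that intersects every member; a \emph{minimum cover} is a cover of minimum cardinality, which is the \emph{covering number} $\tau(\mathcal{C})$. The \emph{blocker} $b(\mathcal{C})$ is the clutter over $V$ of the inclusion-wise minimal covers. For disjoint $I,J\subseteq V$, the \emph{minor} $\mathcal{C}\setminus I/J$ is the clutter over $V-(I\cup J)$ whose members are the inclusion-wise minimal sets in $\{C-J : C\in\mathcal{C},\ C\cap I=\emptyset\}$. A \emph{delta} is a clutter over a ground set $\{a_1,\ldots,a_n\}$ of cardinality $n\ge 3$ whose members are $\{a_2,\ldots,a_n\}$ and $\{a_1,a_i\}$, $i=2,\ldots,n$. An \emph{extended odd hole} is a clutter over a ground set $\{a_1,\ldots,a_n\}$ of odd cardinality $n\geq 5$ whose minimum cardinality members are exactly $\{a_1,a_2\},\{a_2,a_3\},\ldots,\{a_{n-1},a_n\},\{a_n,a_1\}$. A clutter is \emph{clean} if no minor of it is a delta or the blocker of an extended odd hole. It is \emph{tangled} if $\tau(\mathcal{C})=2$ and every element of $V$ belongs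 to a minimum cover. A \emph{fractional packing} is a vector $y\in\mathbb{R}^{\mathcal{C}}_{+}$ with $\sum(y_C : v\in C\in\mathcal{C})\le 1$ for all $v\in V$; its \emph{value} is $\sum_{C\in\mathcal{C}}y_C$. The \emph{core} of $\mathcal{C}$ is $$\mathrm{core}(\mathcal{C})=\{C\in\mathcal{C} : y_C>0 \text{ for some fractional packing } y \text{ of value two}\}.$$ \textbf{Theorem.} Let $\mathcal{C}$ be a clean tangled clutter over ground set $V$, let $G(\mathcal{C})$ be the graph over vertex set $V$ whose edges are the minimum covers of $\mathcal{C}$, and let $r$ be the \emph{rank} of $\mathcal{C}$, i.e. the number of connected components of $G(\mathcal{C})$. Then every connected component of $G(\mathcal{C})$ is bipartite. Moreover, if for each $i\in\{1,\ldots,r\}$ we denote by $\{U_i,V_i\}$ the bipartition of the $i$-th connected component of $G(\mathcal{C})$, then $$\mathrm{core}(\mathcal{C})=\{C\in\mathcal{C} : C\cap(U_i\cup V_i)=U_i \text{ or } C\cap (U_i\cup V_i)=V_i \text{ for all } i\in\{1,\ldots,r\}\}.$$ -/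

import Mathlib

/-- A clutter over a finite ground set: a family of subsets of the ground set, none of which
contains another one. -/
@[ext]
structure Clutter (α : Type*) where
  /-- The ground set; its elements are the elements of the clutter. -/
  ground : Finset α
  /-- The members of the clutter. -/
  members : Finset (Finset α)
  subset_ground : ∀ A ∈ members, A ⊆ ground
  antichain : ∀ A ∈ members, ∀ B ∈ members, A ⊆ B → A = B

namespace Clutter

variable {α : Type*} [DecidableEq α]

/-- The inclusion-wise minimal sets of a finite family of finite sets. -/
def minimalSets (F : Finset (Finset α)) : Finset (Finset α) :=
  F.filter fun A => ∀ B ∈ F, B ⊆ A → B = A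

/-- A cover is a subset of the ground set that intersects every member. -/
def IsCover (C : Clutter α) (B : Finset α) : Prop :=
  B ⊆ C.ground ∧ ∀ A ∈ C.members, (A ∩ B).Nonempty

/-- The finite family of all covers. -/
def covers (C : Clutter α) : Finset (Finset α) :=
  C.ground.powerset.filter fun B => ∀ A ∈ C.members, (A ∩ B).Nonempty

theorem mem_covers (C : Clutter α) (B : Finset α) : B ∈ C.covers ↔ C.IsCover B := by
  simp [covers, IsCover]

/-- The blocker: the clutter of the minimal covers, over the same ground set. -/
def blocker (C : Clutter α) : Clutter α where
  ground := C.ground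
  members := minimalSets C.covers
  subset_ground := by
    intro A hA
    exact ((C.mem_covers A).1 (Finset.mem_filter.1 hA).1).1
  antichain := by
    intro A hA B hB hAB
    exact (Finset.mem_filter.1 hB).2 A (Finset.mem_filter.1 hA).1 hAB

/-- The clutter obtained after deleting `I` and contracting `J`: its members are the
inclusion-wise minimal sets among the `A \ J`, where `A` is a member disjoint from `I`. -/
def minor (C : Clutter α) (I J : Finset α) : Clutter α where
  ground := C.ground \ (I ∪ J)
  members := minimalSets ((C.members.filter fun A => Disjoint A I).image fun A => A \ J)
  subset_ground := by
    intro B hB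
    obtain ⟨A, hA, rfl⟩ := Finset.mem_image.1 (Finset.mem_filter.1 hB).1
    obtain ⟨hA, hI⟩ := Finset.mem_filter.1 hA
    intro x hx
    obtain ⟨hxA, hxJ⟩ := Finset.mem_sdiff.1 hx
    have hxI : x ∉ I := Finset.disjoint_left.1 hI hxA
    simp [C.subset_ground A hA hxA, hxI, hxJ]
  antichain := by
    intro A hA B hB hAB
    exact (Finset.mem_filter.1 hB).2 A (Finset.mem_filter.1 hA).1 hAB

/-- A delta: the ground set `{a₁, …, aₙ}` has at least three elements, and the members are
`{a₂, …, aₙ}` and `{a₁, aᵢ}` for `i = 2, …, n`. -/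
def IsDelta (C : Clutter α) : Prop :=
  3 ≤ C.ground.card ∧ ∃ a ∈ C.ground,
    C.members = insert (C.ground.erase a) ((C.ground.erase a).image fun b => {a, b})

/-- An extended odd hole: the ground set consists of `n` distinct elements `a i`, where `n` is odd
and at least five and the index is cyclic, and the members of minimum cardinality are exactly the
sets `{a i, a (i + 1)}`. -/
def IsExtendedOddHole (C : Clutter α) : Prop :=
  ∃ n : ℕ, 5 ≤ n ∧ Odd n ∧ ∃ a : ZMod n → α, Function.Injective a ∧
    (C.ground : Set α) = Set.range a ∧
    {A : Finset α | A ∈ C.members ∧ ∀ B ∈ C.members, A.card ≤ B.card} =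
      Set.range fun i : ZMod n => ({a i, a (i + 1)} : Finset α)

/-- A clutter is clean if no minor of it is a delta or the blocker of an extended odd hole. -/
def IsClean (C : Clutter α) : Prop :=
  ∀ I J : Finset α, I ⊆ C.ground → J ⊆ C.ground → Disjoint I J →
    ¬ (C.minor I J).IsDelta ∧
    ¬ ∃ E : Clutter α, E.IsExtendedOddHole ∧ C.minor I J = E.blocker

/-- The covering number: the minimum cardinality of a cover (`⊤` if there is no cover, that is,
if the empty set is a member). -/
noncomputable def coveringNumber (C : Clutter α) : ℕ∞ :=
  ⨅ (B : Finset α) (_ : C.IsCover B), (B.card : ℕ∞)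

/-- A minimum cover is a cover of minimum cardinality. -/
def IsMinimumCover (C : Clutter α) (B : Finset α) : Prop :=
  C.IsCover B ∧ ∀ B' : Finset α, C.IsCover B' → B.card ≤ B'.card

/-- A clutter is tangled if its covering number is two and every element belongs to a minimum
cover. -/
def IsTangled (C : Clutter α) : Prop :=
  C.coveringNumber = 2 ∧ ∀ v ∈ C.ground, ∃ B : Finset α, C.IsMinimumCover B ∧ v ∈ B

/-- A fractional packing assigns a nonnegative weight to every member such that, for each element,
the members containing it have total weight at most one. Only the values of `y` at members are
relevant. -/
def IsFractionalPacking (C : Clutter α) (y : Finset α → ℝ) : Prop :=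
  (∀ A ∈ C.members, 0 ≤ y A) ∧
    ∀ v ∈ C.ground, ∑ A ∈ C.members.filter (fun A => v ∈ A), y A ≤ 1

/-- The value of a fractional packing. -/
def packingValue (C : Clutter α) (y : Finset α → ℝ) : ℝ :=
  ∑ A ∈ C.members, y A

open Classical in
/-- The core: the clutter of the members that have positive weight in some fractional packing of
value two. -/
noncomputable def core (C : Clutter α) : Clutter α where
  ground := C.ground
  members := C.members.filter fun A =>
    ∃ y : Finset α → ℝ, C.IsFractionalPacking y ∧ C.packingValue y = 2 ∧ 0 < y A
  subset_ground := by
    intro A hA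
    exact C.subset_ground A (Finset.mem_filter.1 hA).1
  antichain := by
    intro A hA B hB hAB
    exact C.antichain A (Finset.mem_filter.1 hA).1 B (Finset.mem_filter.1 hB).1 hAB

/-- The graph over the ground set whose edges are the minimum covers (for a tangled clutter, these
all have cardinality two). -/
def graph (C : Clutter α) : SimpleGraph {v : α // v ∈ C.ground} where
  Adj u v := u ≠ v ∧ C.IsMinimumCover {u.1, v.1}
  symm := ⟨fun u v h => ⟨h.1.symm, by rw [Finset.pair_comm]; exact h.2⟩⟩
  loopless := ⟨fun _ h => h.1 rfl⟩

/-- The rank: the number of connected components of the graph of the minimum covers. -/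
noncomputable def rank (C : Clutter α) : ℕ :=
  Nat.card C.graph.ConnectedComponent

/-- `{U, V}` is a bipartition of the connected component `K`: the sets `U` and `V` partition the
vertices of `K`, and every edge of `K` has one end in `U` and the other one in `V`. -/
structure IsBipartitionOf (C : Clutter α) (K : C.graph.ConnectedComponent)
    (U V : Finset α) : Prop where
  disjoint : Disjoint U V
  union_eq : ((U ∪ V : Finset α) : Set α) = Subtype.val '' K.supp
  adj : ∀ u v : {v : α // v ∈ C.ground}, u ∈ K.supp → C.graph.Adj u v →
    (u.1 ∈ U ∧ v.1 ∈ V) ∨ (u.1 ∈ V ∧ v.1 ∈ U)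

end Clutter

namespace Clutter

/-! Bipartiteness: a shortest odd closed walk of minimum covers is a chordless odd cycle. A triangle
yields a delta minor, and a longer cycle yields a minor that is the blocker of an extended odd hole,
so a clean clutter has neither (`IsClean.no_odd_closed_walk`).

One inclusion for the core is complementary slackness: the loads at the two ends of a minimum cover
sum to at most two, which is the value of the packing, so a member of positive weight contains
exactly one end. Alternating along walks, it meets each component in one side.

For the converse, the main point is that deleting one side of a component and contracting the other
keeps every cover of size at least two (`IsClean.two_le_card_of_hits`). Otherwise a smallest
offending cover has two elements on the deleted side; an even walk joins them, and shortening this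
walk leads to an excluded minor (`IsClean.no_alternating_walk`). By induction every such minor has a
fractional packing of value two (`IsClean.exists_isMinorPacking`). Given a member `A` that meets
every component in a side, each component contributes a packing that avoids this side, and a
suitable combination of these packings with `A` itself is a packing of value two. -/

/-! ### Shortest odd closed walks. -/

/-- A symmetric irreflexive relation with a closed walk of odd length has a closed walk of odd
length without repeated vertices and without chords. -/
theorem exists_chordless_odd_cycle {β : Type*} (r : β → β → Prop) (hsymm : ∀ x y, r x y → r y x)
    (hirr : ∀ x, ¬ r x x) {n : ℕ} (hn : Odd n) {p : ℕ → β} (hp : p n = p 0)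
    (hr : ∀ i < n, r (p i) (p (i + 1))) :
    ∃ m, Odd m ∧ 3 ≤ m ∧ ∃ q : ℕ → β, q m = q 0 ∧ (∀ i < m, r (q i) (q (i + 1))) ∧
      (∀ i j, i < j → j < m → q i ≠ q j) ∧
      ∀ i j, i < j → j < m → r (q i) (q j) → j = i + 1 ∨ (i = 0 ∧ j + 1 = m) := by
  classical
  have hex : ∃ m, Odd m ∧ ∃ q : ℕ → β, q m = q 0 ∧ ∀ i < m, r (q i) (q (i + 1)) :=
    ⟨n, hn, p, hp, hr⟩
  obtain ⟨hm, q, hq, hqr⟩ := Nat.find_spec hex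
  have hmin : ∀ l < Nat.find hex, Odd l → ∀ s : ℕ → β, s l = s 0 →
      ¬ ∀ i < l, r (s i) (s (i + 1)) :=
    fun l hl ho s hs h => Nat.find_min hex hl ⟨ho, s, hs, h⟩
  generalize Nat.find hex = m at hm hq hqr hmin
  refine ⟨m, hm, ?_, q, hq, hqr, ?_, ?_⟩
  · rcases hm with ⟨k, rfl⟩
    rcases k with _ | k
    · have := hqr 0 (by omega)
      simp only [Nat.mul_zero, Nat.zero_add] at hq this
      rw [hq] at this
      exact absurd this (hirr _)
    · omega
  · intro i j hij hj heq
    -- A repeated vertex splits the closed walk into two shorter ones of total length `m`, so one of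
    -- them is odd.
    by_cases ho : Odd (j - i)
    · refine hmin (j - i) (by omega) ho (fun t => q (i + t)) ?_ ?_
      · simp only [Nat.add_zero]
        rw [heq]; congr 1; omega
      · intro t ht
        exact hqr (i + t) (by omega)
    · refine hmin (m - (j - i)) (by omega) (by grind)
        (fun t => if t ≤ i then q t else q (t + (j - i))) ?_ ?_
      · have : ¬ (m - (j - i) ≤ i) := by omega
        simp only [this, if_false, Nat.zero_le, if_true]
        rw [← hq]; congr 1; omega
      · intro t ht
        rcases lt_trichotomy t i with h | h | h
        · simpa [h.le, Nat.succ_le_of_lt h] using hqr t (by omega)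
        · subst h
          have := hqr j hj
          simp only [le_refl, if_true, heq, Nat.not_succ_le_self, if_false]
          convert this using 2; omega
        · have h1 : ¬ t ≤ i := by omega
          have h2 : ¬ t + 1 ≤ i := by omega
          simp only [h1, h2, if_false]
          convert hqr (t + (j - i)) (by omega) using 2; omega
  · intro i j hij hj hrij
    by_contra hcon
    push Not at hcon
    -- A chord closes up both arcs; the two lengths sum to `m + 2`, so one is odd, and `hcon` makes
    -- both smaller than `m`.
    by_cases ho : Odd (j - i + 1)
    · refine hmin (j - i + 1) (by omega) ho (fun t => if t ≤ j - i then q (i + t) else q i) ?_ ?_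
      · simp
      · intro t ht
        rcases Nat.lt_succ_iff_lt_or_eq.1 ht with h | h
        · simpa [h.le, Nat.succ_le_of_lt h, Nat.add_assoc] using hqr (i + t) (by omega)
        · subst h
          simp only [le_refl, if_true, Nat.not_succ_le_self, if_false]
          rw [Nat.add_sub_cancel' hij.le]
          exact hsymm _ _ hrij
    · refine hmin (m - (j - i) + 1) (by omega) (by grind)
        (fun t => if t ≤ i then q t else q (t + (j - i) - 1)) ?_ ?_
      · have : ¬ (m - (j - i) + 1 ≤ i) := by omega
        simp only [this, if_false, Nat.zero_le, if_true]
        rw [← hq]; congr 1; omega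
      · intro t ht
        rcases lt_trichotomy t i with h | h | h
        · simpa [h.le, Nat.succ_le_of_lt h] using hqr t (by omega)
        · subst h
          simp only [le_refl, if_true, Nat.not_succ_le_self, if_false]
          convert hrij using 2; omega
        · have h1 : ¬ t ≤ i := by omega
          have h2 : ¬ t + 1 ≤ i := by omega
          simp only [h1, h2, if_false]
          convert hqr (t + (j - i) - 1) (by omega) using 2; omega

/-! ### Covers of minors and of blockers. -/

variable {α : Type*} [DecidableEq α]

/-- A set hits a clutter if it intersects every member. -/
def Hits (C : Clutter α) (S : Finset α) : Prop :=
  ∀ A ∈ C.members, (A ∩ S).Nonempty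

theorem Hits.mono {C : Clutter α} {S T : Finset α} (h : C.Hits S) (hST : S ⊆ T) : C.Hits T :=
  fun A hA => (h A hA).mono (Finset.inter_subset_inter_left hST)

theorem not_hits {C : Clutter α} {S : Finset α} :
    ¬ C.Hits S ↔ ∃ A ∈ C.members, Disjoint A S := by
  simp [Hits, Finset.not_nonempty_iff_eq_empty, Finset.disjoint_iff_inter_eq_empty]

theorem isCover_iff {C : Clutter α} {S : Finset α} : C.IsCover S ↔ S ⊆ C.ground ∧ C.Hits S :=
  Iff.rfl

theorem exists_mem_minimalSets_subset {F : Finset (Finset α)} {A : Finset α} (hA : A ∈ F) :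
    ∃ B ∈ minimalSets F, B ⊆ A := by
  obtain ⟨B, hBA, hB⟩ := F.finite_toSet.exists_le_minimal (a := A) hA
  refine ⟨B, Finset.mem_filter.2 ⟨hB.1, fun D hD hDB => ?_⟩, hBA⟩
  exact hDB.antisymm (hB.2 hD hDB)

theorem mem_minor_members {C : Clutter α} {I J A : Finset α} (hA : A ∈ C.members)
    (hI : Disjoint A I) : ∃ B ∈ (C.minor I J).members, B ⊆ A \ J :=
  exists_mem_minimalSets_subset (Finset.mem_image_of_mem _ (Finset.mem_filter.2 ⟨hA, hI⟩))

theorem exists_of_mem_minor_members {C : Clutter α} {I J B : Finset α}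
    (hB : B ∈ (C.minor I J).members) : ∃ A ∈ C.members, Disjoint A I ∧ A \ J = B := by
  obtain ⟨A, hA, rfl⟩ := Finset.mem_image.1 (Finset.mem_filter.1 hB).1
  exact ⟨A, (Finset.mem_filter.1 hA).1, (Finset.mem_filter.1 hA).2, rfl⟩

/-- This translates covers of a minor into covers of `C` containing `I`, so that later arguments can
stay inside `C`. -/
theorem minor_hits_iff {C : Clutter α} {I J S : Finset α} (hS : Disjoint S J) :
    (C.minor I J).Hits S ↔ C.Hits (I ∪ S) := by
  constructor
  · intro h A hA
    by_cases hI : Disjoint A I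
    · obtain ⟨B, hB, hBA⟩ := mem_minor_members (J := J) hA hI
      refine (h B hB).mono fun x hx => ?_
      have := hBA (Finset.mem_inter.1 hx).1
      grind
    · obtain ⟨x, h1, h2⟩ := Finset.not_disjoint_iff.1 hI
      exact ⟨x, by simp [h1, h2]⟩
  · intro h B hB
    obtain ⟨A, hA, hI, rfl⟩ := exists_of_mem_minor_members hB
    obtain ⟨x, hx⟩ := h A hA
    refine ⟨x, ?_⟩
    have h1 : x ∈ A → x ∉ I := fun h => Finset.disjoint_left.1 hI h
    have h2 : x ∈ S → x ∉ J := fun h => Finset.disjoint_left.1 hS h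
    grind

theorem mem_blocker_members {C : Clutter α} {S : Finset α} :
    S ∈ C.blocker.members ↔ C.IsCover S ∧ ∀ T, C.IsCover T → T ⊆ S → T = S := by
  simp [blocker, minimalSets, mem_covers]

/-- If no member lies in `A`, then the complement of `A` is a cover, and a minimal cover inside it
misses `A`. -/
theorem blocker_hits_iff {C : Clutter α} {A : Finset α} :
    C.blocker.Hits A ↔ ∃ B ∈ C.members, B ⊆ A := by
  constructor
  · intro h
    by_contra hcon
    push Not at hcon
    have hcov : C.IsCover (C.ground \ A) := by
      refine ⟨Finset.sdiff_subset, fun B hB => ?_⟩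
      obtain ⟨x, hx, hxA⟩ := Finset.not_subset.1 (hcon B hB)
      exact ⟨x, by simp [hx, hxA, C.subset_ground B hB hx]⟩
    obtain ⟨S, hS, hSA⟩ := exists_mem_minimalSets_subset ((C.mem_covers _).2 hcov)
    obtain ⟨x, hx⟩ := h S hS
    have := hSA (Finset.mem_inter.1 hx).1
    grind
  · rintro ⟨B, hB, hBA⟩ S hS
    rw [Finset.inter_comm]
    exact ((mem_blocker_members.1 hS).1.2 B hB).mono (Finset.inter_subset_inter_right hBA)

theorem blocker_isCover_iff {C : Clutter α} {A : Finset α} :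
    C.blocker.IsCover A ↔ A ⊆ C.ground ∧ ∃ B ∈ C.members, B ⊆ A := by
  rw [isCover_iff, blocker_hits_iff]
  rfl

theorem blocker_blocker (C : Clutter α) : C.blocker.blocker = C := by
  have key : ∀ A, A ∈ C.blocker.blocker.members ↔ A ∈ C.members := by
    intro A
    rw [mem_blocker_members]
    simp only [blocker_isCover_iff]
    constructor
    · rintro ⟨⟨hA, B, hB, hBA⟩, hmin⟩
      rw [← hmin B ⟨C.subset_ground B hB, B, hB, subset_rfl⟩ hBA]
      exact hB
    · intro hA
      refine ⟨⟨C.subset_ground A hA, A, hA, subset_rfl⟩, fun T hT hTA => ?_⟩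
      obtain ⟨-, B, hB, hBT⟩ := hT
      have := C.antichain B hB A hA (hBT.trans hTA)
      exact hTA.antisymm (this ▸ hBT)
  ext1
  · rfl
  · exact Finset.ext key


/-! ### Finding the excluded minors. -/

/-- Enlarge `Y` to a maximal `T ⊆ D` for which `T ∪ {v}` is not a cover. Deleting `T` and
contracting everything outside `D ∪ {v}` leaves a delta with centre `v`: maximality makes each `{v,
d}` a cover of the minor, and criticality of `d` in `D` makes it a member. The elements `u` and `w`
survive, so the ground set has at least three elements. -/
theorem IsClean.no_delta {C : Clutter α} (hC : C.IsClean) {D Y : Finset α} {v u w : α}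
    (hDg : D ⊆ C.ground) (hD : C.Hits D) (hYD : Y ⊆ D)
    (hmin : ∀ d ∈ D \ Y, ¬ C.Hits (D.erase d)) (hvg : v ∈ C.ground) (hvD : v ∉ D)
    (hY : ¬ C.Hits (Y ∪ {v})) (huw : u ≠ w) (hu : u ∈ D) (hw : w ∈ D)
    (hvu : C.Hits (Y ∪ {v, u})) (hvw : C.Hits (Y ∪ {v, w})) : False := by
  classical
  obtain ⟨T, hYT, hT⟩ := (D.powerset.filter fun T => ¬ C.Hits (T ∪ {v})).finite_toSet
    |>.exists_le_maximal (a := Y) (by simpa [hYD] using hY)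
  have hTD : T ⊆ D := by have := hT.1; simp at this; exact this.1
  have hTv : ¬ C.Hits (T ∪ {v}) := by have := hT.1; simp at this; simpa using this.2
  have hYT : Y ⊆ T := hYT
  have hmax : ∀ d ∈ D \ T, C.Hits (T ∪ {v, d}) := by
    intro d hd
    obtain ⟨hdD, hdT⟩ := Finset.mem_sdiff.1 hd
    by_contra hcon
    refine hdT (hT.2 (y := insert d T) ?_ (Finset.subset_insert d T) (Finset.mem_insert_self d T))
    have h1 : insert d T ⊆ D := Finset.insert_subset hdD hTD
    have h2 : insert d T ∪ {v} = T ∪ {v, d} := by grind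
    simp only [Finset.coe_filter, Finset.mem_powerset, Set.mem_ofPred_eq, h2]
    exact ⟨h1, hcon⟩
  have huT : u ∉ T := fun h => hTv (hvu.mono (by grind))
  have hwT : w ∉ T := fun h => hTv (hvw.mono (by grind))
  set J := C.ground \ (insert v D) with hJ
  have hground : (C.minor T J).ground = insert v (D \ T) := by
    simp only [minor, hJ]
    ext x
    have h1 := @hDg x
    have h2 := @hTD x
    grind
  have herase : (C.minor T J).ground.erase v = D \ T := by
    rw [hground, Finset.erase_insert (by simp [hvD])]
  have hsd : ∀ A ∈ C.members, A \ J = A ∩ insert v D := by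
    intro A hA
    have := C.subset_ground A hA
    ext x
    have := @this x
    grind
  -- members avoiding `T` and `v` contain the rest of `D`
  have havoid : ∀ A ∈ C.members, Disjoint A T → v ∉ A → D \ T ⊆ A := by
    intro A hA hAT hvA d hd
    obtain ⟨x, hx⟩ := hmax d hd A hA
    have := fun h : x ∈ A => Finset.disjoint_left.1 hAT h
    grind
  have hpair : ∀ d ∈ D \ T, ∃ B ∈ (C.minor T J).members, B ⊆ {v, d} := by
    intro d hd
    obtain ⟨hdD, hdT⟩ := Finset.mem_sdiff.1 hd
    obtain ⟨A, hA, hAd⟩ := not_hits.1 (hmin d (by grind))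
    have hAT : Disjoint A T := hAd.mono_right (by grind)
    obtain ⟨B, hB, hBA⟩ := mem_minor_members (J := J) hA hAT
    refine ⟨B, hB, hBA.trans ?_⟩
    rw [hsd A hA]
    intro x hx
    have := fun h : x ∈ A => Finset.disjoint_left.1 hAd h
    grind
  have hsub : ∀ B ∈ (C.minor T J).members, B = D \ T ∨ ∃ d ∈ D \ T, {v, d} = B := by
    intro B hB
    obtain ⟨A, hA, hAT, hAB⟩ := exists_of_mem_minor_members hB
    rw [hsd A hA] at hAB
    by_cases hvA : v ∈ A
    · right
      obtain ⟨d, hd⟩ := hD A hA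
      have hdT := fun h : d ∈ A => Finset.disjoint_left.1 hAT h
      have hdR : d ∈ D \ T := by grind
      obtain ⟨B', hB', hBd⟩ := hpair d hdR
      have hdB : {v, d} ⊆ B := by rw [← hAB]; grind
      have := (C.minor T J).antichain B' hB' B hB (hBd.trans hdB)
      exact ⟨d, hdR, hdB.antisymm (this ▸ hBd)⟩
    · left
      have := havoid A hA hAT hvA
      rw [← hAB]
      ext x
      have := @this x
      have := fun h : x ∈ A => Finset.disjoint_left.1 hAT h
      grind
  refine (hC T J (hTD.trans hDg) Finset.sdiff_subset ?_).1 ⟨?_, v, ?_, ?_⟩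
  · rw [Finset.disjoint_left]
    grind
  · rw [hground, ← Finset.card_eq_three.2 ⟨v, u, w, by grind, by grind, huw, rfl⟩]
    apply Finset.card_le_card
    grind
  · rw [hground]; exact Finset.mem_insert_self _ _
  · rw [herase]
    ext B
    simp only [Finset.mem_insert, Finset.mem_image]
    refine ⟨hsub B, ?_⟩
    rintro (rfl | ⟨d, hd, rfl⟩)
    -- A member avoiding `T ∪ {v}` yields a member of the minor without `v`, which can only be `D \
    -- T`.
    · obtain ⟨A, hA, hAT⟩ := not_hits.1 hTv
      obtain ⟨B, hB, hBA⟩ := mem_minor_members (J := J) hA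
        (hAT.mono_right Finset.subset_union_left)
      have hvA := fun h : v ∈ A => Finset.disjoint_left.1 hAT h
      rcases hsub B hB with rfl | ⟨d, hd, rfl⟩
      · exact hB
      · have := @hBA v
        grind
    · obtain ⟨B, hB, hBd⟩ := hpair d hd
      -- `D \ T` contains both `u` and `w`, so it does not fit inside `{v, d}`.
      rcases hsub B hB with rfl | ⟨e, he, rfl⟩
      · have h1 := @hBd u
        have h2 := @hBd w
        grind
      · have h1 := @hBd e
        have : e = d := by grind
        rw [← this]; exact hB

/-- No cover of `M` has fewer than two elements, so the minimum members of the blocker are the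
two-element covers, and chordlessness leaves only the edges of the cycle. -/
theorem isExtendedOddHole_blocker {M : Clutter α} {m : ℕ} (h5 : 5 ≤ m) (hm : Odd m) {q : ℕ → α}
    (hqm : q m = q 0) (hinj : ∀ i j, i < j → j < m → q i ≠ q j)
    (hground : M.ground = (Finset.range m).image q)
    (h1 : ∀ i < m, ¬ M.Hits {q i}) (h2 : ∀ i < m, M.Hits {q i, q (i + 1)})
    (hch : ∀ i j, i < j → j < m → M.Hits {q i, q j} → j = i + 1 ∨ (i = 0 ∧ j + 1 = m)) :
    M.blocker.IsExtendedOddHole := by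
  have : NeZero m := ⟨by omega⟩
  have hsucc : ∀ i : ZMod m, q (i + 1).val = q (i.val + 1) := by
    intro i
    have hi := ZMod.val_lt i
    have : (i + 1).val = (i.val + 1) % m := by
      rw [← ZMod.val_natCast]; simp
    rw [this]
    rcases Nat.lt_or_eq_of_le (Nat.succ_le_of_lt hi) with h | h
    · rw [Nat.mod_eq_of_lt h]
    · have h : i.val + 1 = m := h
      rw [h, Nat.mod_self, hqm]
  have hval : ∀ i < m, ∃ a : ZMod m, a.val = i := fun i hi =>
    ⟨(i : ZMod m), ZMod.val_cast_of_lt hi⟩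
  have hinj' : Function.Injective fun i : ZMod m => q i.val := by
    intro i j hij
    apply ZMod.val_injective m
    rcases lt_trichotomy i.val j.val with h | h | h
    · exact absurd hij (hinj _ _ h (ZMod.val_lt j))
    · exact h
    · exact absurd hij.symm (hinj _ _ h (ZMod.val_lt i))
  have hcard : ∀ S, M.IsCover S → 2 ≤ S.card := by
    intro S hS
    by_contra hlt
    rcases Nat.le_one_iff_eq_zero_or_eq_one.1 (by omega : S.card ≤ 1) with h | h
    · rw [Finset.card_eq_zero] at h
      subst h
      exact h1 0 (by omega) (Hits.mono hS.2 (Finset.empty_subset _))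
    · obtain ⟨x, rfl⟩ := Finset.card_eq_one.1 h
      have := hS.1 (Finset.mem_singleton_self x)
      rw [hground] at this
      obtain ⟨i, hi, rfl⟩ := Finset.mem_image.1 this
      exact h1 i (Finset.mem_range.1 hi) hS.2
  have hne : ∀ i : ZMod m, q i.val ≠ q (i + 1).val := by
    intro i h
    have : Fact (1 < m) := ⟨by omega⟩
    have : i = i + 1 := hinj' h
    exact one_ne_zero (left_eq_add.1 this)
  have hmemg : ∀ i : ZMod m, q i.val ∈ M.ground := by
    intro i
    rw [hground]
    exact Finset.mem_image_of_mem _ (Finset.mem_range.2 (ZMod.val_lt i))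
  have hpair : ∀ i : ZMod m, ({q i.val, q (i + 1).val} : Finset α) ∈ M.blocker.members := by
    intro i
    refine mem_blocker_members.2 ⟨⟨?_, ?_⟩, fun T hT hTS => ?_⟩
    · exact Finset.insert_subset (hmemg _) (Finset.singleton_subset_iff.2 (hmemg _))
    · have := h2 i.val (ZMod.val_lt i)
      rw [← hsucc] at this
      exact this
    · refine Finset.eq_of_subset_of_card_le hTS ?_
      rw [Finset.card_pair (hne i)]
      exact hcard T hT
  refine ⟨m, h5, hm, fun i => q i.val, hinj', ?_, ?_⟩
  · change (M.ground : Set α) = _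
    rw [hground]
    ext x
    simp only [Finset.coe_image, Finset.coe_range, Set.mem_image, Set.mem_Iio, Set.mem_range]
    constructor
    · rintro ⟨i, hi, rfl⟩
      obtain ⟨a, rfl⟩ := hval i hi
      exact ⟨a, rfl⟩
    · rintro ⟨a, rfl⟩
      exact ⟨a.val, ZMod.val_lt a, rfl⟩
  · ext A
    simp only [Set.mem_ofPred_eq, Set.mem_range]
    constructor
    · rintro ⟨hA, hAmin⟩
      have hcov := (mem_blocker_members.1 hA).1
      have hle := hAmin _ (hpair 0)
      rw [Finset.card_pair (hne 0)] at hle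
      obtain ⟨x, y, hxy, rfl⟩ := Finset.card_eq_two.1 (hle.antisymm (hcard A hcov))
      have hx := hcov.1 (Finset.mem_insert_self x _)
      have hy := hcov.1 (Finset.mem_insert_of_mem (Finset.mem_singleton_self y))
      rw [hground] at hx hy
      obtain ⟨i, hi, rfl⟩ := Finset.mem_image.1 hx
      obtain ⟨j, hj, rfl⟩ := Finset.mem_image.1 hy
      rw [Finset.mem_range] at hi hj
      have key : ∀ i j, i < j → j < m → M.Hits {q i, q j} →
          ∃ a : ZMod m, ({q a.val, q (a + 1).val} : Finset α) = {q i, q j} := by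
        intro i j hij hj hh
        rcases hch i j hij hj hh with rfl | ⟨rfl, hjm⟩
        · obtain ⟨a, rfl⟩ := hval i (by omega)
          exact ⟨a, by rw [hsucc]⟩
        · obtain ⟨a, rfl⟩ := hval j hj
          exact ⟨a, by rw [hsucc, hjm, hqm, Finset.pair_comm]⟩
      rcases lt_trichotomy i j with h | rfl | h
      · exact key i j h hj hcov.2
      · exact absurd rfl hxy
      · rw [Finset.pair_comm (q i)]
        exact key j i h hi (by rw [Finset.pair_comm]; exact hcov.2)
    · rintro ⟨i, rfl⟩
      refine ⟨hpair i, fun B hB => ?_⟩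
      rw [Finset.card_pair (hne i)]
      exact hcard B (mem_blocker_members.1 hB).1

/-- The sets of size two whose union with `I` hits a clean clutter form a bipartite graph. -/
theorem IsClean.no_odd_closed_walk {C : Clutter α} (hC : C.IsClean) {I : Finset α}
    (hI : I ⊆ C.ground) {n : ℕ} (hn : Odd n) {p : ℕ → α} (hp : p n = p 0)
    (h1 : ∀ i < n, ¬ C.Hits (I ∪ {p i})) (h2 : ∀ i < n, C.Hits (I ∪ {p i, p (i + 1)})) :
    False := by
  have hn0 := hn.pos
  have h1' : ∀ i ≤ n, ¬ C.Hits (I ∪ {p i}) := by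
    intro i hi
    rcases hi.lt_or_eq with h | rfl
    · exact h1 i h
    · rw [hp]; exact h1 0 hn0
  obtain ⟨m, hm, h3, q, hqm, hqr, hinj, hch⟩ := exists_chordless_odd_cycle
    (fun x y => (¬ C.Hits (I ∪ {x}) ∧ ¬ C.Hits (I ∪ {y})) ∧ C.Hits (I ∪ {x, y}))
    (fun x y h => ⟨h.1.symm, by rw [Finset.pair_comm]; exact h.2⟩)
    (fun x h => h.1.1 (by simpa using h.2)) hn hp
    (fun i hi => ⟨⟨h1 i hi, h1' (i + 1) hi⟩, h2 i hi⟩)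
  have hq1 : ∀ i < m, ¬ C.Hits (I ∪ {q i}) := fun i hi => (hqr i hi).1.1
  have hqI : ∀ i < m, q i ∉ I := by
    intro i hi hmem
    exact (hqr i hi).1.2 ((hqr i hi).2.mono (by grind))
  have hqg : ∀ i < m, q i ∈ C.ground := by
    intro i hi
    obtain ⟨A, hA, hd⟩ := not_hits.1 (hqr i hi).1.2
    obtain ⟨x, hx⟩ := (hqr i hi).2 A hA
    have := fun h : x ∈ A => Finset.disjoint_left.1 hd h
    have : x = q i := by grind
    subst this
    exact C.subset_ground A hA (Finset.mem_inter.1 hx).1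
  rcases Nat.lt_or_ge m 5 with h5 | h5
  · obtain rfl : m = 3 := by rcases hm with ⟨k, rfl⟩; omega
    have h01 := hinj 0 1 (by omega) (by omega)
    have h02 := hinj 0 2 (by omega) (by omega)
    have h12 := hinj 1 2 (by omega) (by omega)
    have hi0 := hqI 0 (by omega)
    have hi1 := hqI 1 (by omega)
    have hi2 := hqI 2 (by omega)
    -- For a triangle, one edge together with `I` serves as the cover and the third vertex as the
    -- centre of the delta.
    refine hC.no_delta (D := I ∪ {q 1, q 2}) (Y := I) (v := q 0) (u := q 1) (w := q 2) ?_
      (hqr 1 (by omega)).2 Finset.subset_union_left ?_ (hqg 0 (by omega)) (by grind)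
      (hq1 0 (by omega)) h12 (by simp) (by simp) (hqr 0 (by omega)).2 ?_
    · have := hqg 1 (by omega)
      have := hqg 2 (by omega)
      grind
    · intro d hd
      have : d = q 1 ∨ d = q 2 := by grind
      rcases this with rfl | rfl
      · exact fun h => hq1 2 (by omega) (h.mono (by grind))
      · exact fun h => hq1 1 (by omega) (h.mono (by grind))
    · have := (hqr 2 (by omega)).2
      rw [hqm, Finset.pair_comm] at this
      exact this
  · set P := (Finset.range m).image q with hP
    have hPg : P ⊆ C.ground := by
      intro x hx
      obtain ⟨i, hi, rfl⟩ := Finset.mem_image.1 hx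
      exact hqg i (Finset.mem_range.1 hi)
    have hPI : ∀ x ∈ P, x ∉ I := by
      intro x hx
      obtain ⟨i, hi, rfl⟩ := Finset.mem_image.1 hx
      exact hqI i (Finset.mem_range.1 hi)
    have hqP : ∀ i < m, q i ∈ P := fun i hi => Finset.mem_image_of_mem _ (Finset.mem_range.2 hi)
    have hqP' : ∀ i ≤ m, q i ∈ P := by
      intro i hi
      rcases hi.lt_or_eq with h | rfl
      · exact hqP i h
      · rw [hqm]; exact hqP 0 (by omega)
    -- After this contraction the ground set is exactly the vertex set of the cycle.
    set J := C.ground \ (I ∪ P) with hJ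
    have hdisj : ∀ S ⊆ P, Disjoint S J := by
      intro S hS
      rw [Finset.disjoint_left]
      grind
    have hhits : ∀ S ⊆ P, ((C.minor I J).Hits S ↔ C.Hits (I ∪ S)) :=
      fun S hS => minor_hits_iff (hdisj S hS)
    refine (hC I J hI Finset.sdiff_subset ?_).2 ⟨(C.minor I J).blocker, ?_,
      (blocker_blocker _).symm⟩
    · rw [Finset.disjoint_left]
      grind
    · refine isExtendedOddHole_blocker h5 hm hqm hinj ?_ ?_ ?_ ?_
      · change C.ground \ (I ∪ J) = P
        ext x
        have := hPI x
        have := @hPg x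
        grind
      · intro i hi
        rw [hhits _ (Finset.singleton_subset_iff.2 (hqP i hi))]
        exact hq1 i hi
      · intro i hi
        rw [hhits _ (Finset.insert_subset (hqP i hi) (Finset.singleton_subset_iff.2 (hqP' _ hi)))]
        exact (hqr i hi).2
      · intro i j hij hj hh
        rw [hhits _ (Finset.insert_subset (hqP i (hij.trans hj))
          (Finset.singleton_subset_iff.2 (hqP j hj)))] at hh
        exact hch i j hij hj ⟨⟨hq1 i (hij.trans hj), hq1 j hj⟩, hh⟩


/-! ### Shortening alternating walks. -/

/-- Let `D` be a cover of minimum cardinality among those between `W` and `U ∪ W`. After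
contracting a part of `D`, no alternating walk of even length joins two distinct remaining elements
of `D`. -/
theorem IsClean.no_alternating_walk {C : Clutter α} (hC : C.IsClean) {U V W D : Finset α}
    (hDg : D ⊆ C.ground) (hVg : V ⊆ C.ground) (hDU : D ⊆ U ∪ W) (hVD : Disjoint V D)
    (hD : C.Hits D)
    (hmin : ∀ D', W ⊆ D' → D' ⊆ U ∪ W → C.Hits D' → D.card ≤ D'.card) (k : ℕ) :
    ∀ (Y : Finset α) (p : ℕ → α), W ⊆ Y → Y ⊆ D → p 0 ∈ D \ Y → p (2 * k) ∈ D \ Y →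
      p 0 ≠ p (2 * k) → (∀ i ≤ 2 * k, Even i → p i ∈ U) → (∀ i ≤ 2 * k, Odd i → p i ∈ V) →
      (∀ i < 2 * k, C.Hits (Y ∪ {p i, p (i + 1)})) → (∀ i ≤ 2 * k, ¬ C.Hits (Y ∪ {p i})) →
      False := by
  induction k using Nat.strong_induction_on with
  | _ k ih =>
  intro Y p hWY hYD h0 hk hne hU hV hedge hvert
  obtain ⟨h0D, h0Y⟩ := Finset.mem_sdiff.1 h0
  obtain ⟨hkD, hkY⟩ := Finset.mem_sdiff.1 hk
  have herase : ∀ d ∈ D, d ∉ W → ¬ C.Hits (D.erase d) := by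
    intro d hd hdW hh
    have h1 := hmin (D.erase d) (fun x hx => Finset.mem_erase.2
      ⟨fun h => hdW (h ▸ hx), hYD (hWY hx)⟩) ((Finset.erase_subset _ _).trans hDU) hh
    have h2 := Finset.card_erase_lt_of_mem hd
    omega
  have hk0 : k ≠ 0 := by rintro rfl; exact hne rfl
  by_cases hk1 : k = 1
  · subst hk1
    have hp1 := hV 1 (by omega) odd_one
    refine hC.no_delta (v := p 1) hDg hD hYD (fun d hd => ?_) (hVg hp1)
      (Finset.disjoint_left.1 hVD hp1) (hvert 1 (by omega)) hne h0D hkD ?_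
      (hedge 1 (by omega))
    · obtain ⟨hd1, hd2⟩ := Finset.mem_sdiff.1 hd
      exact herase d hd1 fun h => hd2 (hWY h)
    · rw [Finset.pair_comm]
      exact hedge 0 (by omega)
  -- Adding both ends to `X` gives back the cover `D`. So relative to `X` the ends are adjacent and
  -- the walk closes to one of length `2 * k + 1`, which is impossible unless some single vertex
  -- completes `X` to a cover.
  set X := (D.erase (p 0)).erase (p (2 * k)) with hX
  have hYX : Y ⊆ X := by
    intro x hx
    have := hYD hx
    grind
  have hXD : X ⊆ D := (Finset.erase_subset _ _).trans (Finset.erase_subset _ _)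
  by_cases hcase : ∀ i ≤ 2 * k, ¬ C.Hits (X ∪ {p i})
  · refine hC.no_odd_closed_walk (hXD.trans hDg) (n := 2 * k + 1) ⟨k, rfl⟩
      (p := fun i => if i ≤ 2 * k then p i else p 0) (by simp) ?_ ?_
    · intro i hi
      have hi' : i ≤ 2 * k := by omega
      simpa [hi'] using hcase i hi'
    · intro i hi
      rcases Nat.lt_succ_iff_lt_or_eq.1 hi with h | rfl
      · have h1 : i + 1 ≤ 2 * k := h
        simp only [h.le, h1, if_true]
        exact (hedge i h).mono (Finset.union_subset_union_left hYX)
      · simp only [le_refl, if_true, Nat.not_succ_le_self, if_false]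
        exact hD.mono (by grind)
  · push Not at hcase
    obtain ⟨i0, hi0, hhit0⟩ := hcase
    classical
    obtain ⟨X', hX'mem, hX'min⟩ := Finset.exists_min_image
      (X.powerset.filter fun Z => Y ⊆ Z ∧ ∃ i ≤ 2 * k, C.Hits (Z ∪ {p i})) Finset.card
      ⟨X, by simp only [Finset.mem_filter, Finset.mem_powerset]
             exact ⟨subset_rfl, hYX, i0, hi0, hhit0⟩⟩
    simp only [Finset.mem_filter, Finset.mem_powerset] at hX'mem hX'min
    obtain ⟨hX'X, hYX', i, hi, hhit⟩ := hX'mem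
    have hX'D := hX'X.trans hXD
    -- For even `i` the cover `X' ∪ {p i}` lies between `W` and `U ∪ W` and is smaller than `D`,
    -- since `X'` lost both ends. For odd `i`, an element `y` of `X' \ Y` becomes adjacent to `p i`
    -- relative to `X'.erase y`, and minimality of `X'` keeps single vertices from completing that
    -- set.
    rcases Nat.even_or_odd i with hev | hodd
    · have hlt := hmin (X' ∪ {p i}) ((hWY.trans hYX').trans Finset.subset_union_left)
        (Finset.union_subset (hX'D.trans hDU) (Finset.singleton_subset_iff.2
          (Finset.mem_union_left _ (hU i hi hev)))) hhit
      have h1 := Finset.card_union_le X' {p i}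
      have h2 := Finset.card_le_card hX'X
      have h3 : X.card < (D.erase (p 0)).card :=
        Finset.card_erase_lt_of_mem (Finset.mem_erase.2 ⟨hne.symm, hkD⟩)
      have h4 := Finset.card_erase_lt_of_mem h0D
      rw [Finset.card_singleton] at h1
      omega
    · obtain ⟨y, hyX', hyY⟩ : ∃ y ∈ X', y ∉ Y := by
        by_contra hcon
        push Not at hcon
        exact hvert i hi (hhit.mono (Finset.union_subset_union_left hcon))
      set Z := X'.erase y with hZ
      have hyX := hX'X hyX'
      have hyD : y ∈ D := hXD hyX
      have hy0 : y ≠ p 0 := by grind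
      have hyk : y ≠ p (2 * k) := by grind
      have hYZ : Y ⊆ Z := fun x hx =>
        Finset.mem_erase.2 ⟨fun h => hyY (h ▸ hx), hYX' hx⟩
      have hZX' : Z ⊆ X' := Finset.erase_subset _ _
      have hZv : ∀ j ≤ 2 * k, ¬ C.Hits (Z ∪ {p j}) := by
        intro j hj hh
        have h1 := hX'min Z ⟨hZX'.trans hX'X, hYZ, j, hj, hh⟩
        exact (Finset.card_erase_lt_of_mem hyX').not_ge h1
      have h0W : p 0 ∉ W := fun h => h0Y (hWY h)
      have h0X : p 0 ∉ X := by grind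
      have hkX : p (2 * k) ∉ X := by grind
      have hZy : ¬ C.Hits (Z ∪ {y}) := by
        intro hh
        refine herase (p 0) h0D h0W (hh.mono ?_)
        intro x hx
        have h1 := @hZX' x
        have h2 := @hX'X x
        have h3 := @hXD x
        grind
      have hZi : C.Hits (Z ∪ {p i, y}) := hhit.mono (by
        intro x hx
        by_cases hxy : x = y <;> grind)
      have hyU : y ∈ U := by
        rcases Finset.mem_union.1 (hDU hyD) with h | h
        · exact h
        · exact absurd (hWY h) hyY
      have hyDZ : y ∈ D \ Z := Finset.mem_sdiff.2 ⟨hyD, Finset.notMem_erase y X'⟩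
      have hZedge : ∀ j < 2 * k, C.Hits (Z ∪ {p j, p (j + 1)}) := fun j hj =>
        (hedge j hj).mono (Finset.union_subset_union_left hYZ)
      obtain ⟨l, hl⟩ := hodd
      -- The two detours to `y` have lengths `2 * (l + 1)` and `2 * (k - l)`. If the first is not
      -- shorter than the walk, then `l = k - 1`, and the second has length two, which is shorter
      -- because `k ≥ 2`.
      by_cases hshort : l + 1 < k
      · -- follow the walk from its start to `p i`, then go to `y`
        obtain ⟨q, hval, hend⟩ : ∃ q : ℕ → α, (∀ j ≤ i, q j = p j) ∧ ∀ j, i < j → q j = y :=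
          ⟨fun j => if j ≤ i then p j else y, fun j hj => if_pos hj, fun j hj => if_neg hj.not_ge⟩
        refine ih (l + 1) hshort Z q (hWY.trans hYZ)
          (hZX'.trans hX'D) ?_ ?_ ?_ ?_ ?_ ?_ ?_
        · rw [hval 0 (by omega)]
          exact Finset.mem_sdiff.2 ⟨h0D, fun h => h0X (hX'X (hZX' h))⟩
        · rw [hend _ (by omega)]; exact hyDZ
        · rw [hval 0 (by omega), hend _ (by omega)]; exact hy0.symm
        · intro j hj hje
          by_cases hji : j ≤ i
          · rw [hval j hji]; exact hU j (by omega) hje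
          · rw [hend j (by omega)]; exact hyU
        · intro j hj hjo
          have hji : j ≤ i := by rcases hjo with ⟨t, rfl⟩; omega
          rw [hval j hji]; exact hV j (by omega) hjo
        · intro j hj
          have hji : j ≤ i := by omega
          rw [hval j hji]
          rcases hji.lt_or_eq with h | rfl
          · rw [hval (j + 1) h]; exact hZedge j (by omega)
          · rw [hend (j + 1) (by omega)]; exact hZi
        · intro j hj
          by_cases hji : j ≤ i
          · rw [hval j hji]; exact hZv j (by omega)
          · rw [hend j (by omega)]; exact hZy
      · -- follow the walk backwards from its end to `p i`, then go to `y`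
        have hl0 : k - l < k := by omega
        set t := 2 * k - i with ht
        obtain ⟨q, hval, hend⟩ : ∃ q : ℕ → α,
            (∀ j ≤ t, q j = p (2 * k - j)) ∧ ∀ j, t < j → q j = y :=
          ⟨fun j => if j ≤ t then p (2 * k - j) else y, fun j hj => if_pos hj,
            fun j hj => if_neg hj.not_ge⟩
        refine ih (k - l) hl0 Z q (hWY.trans hYZ)
          (hZX'.trans hX'D) ?_ ?_ ?_ ?_ ?_ ?_ ?_
        · rw [hval 0 (by omega)]
          exact Finset.mem_sdiff.2 ⟨hkD, fun h => hkX (hX'X (hZX' h))⟩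
        · rw [hend _ (by omega)]; exact hyDZ
        · rw [hval 0 (by omega), hend _ (by omega)]; exact hyk.symm
        · intro j hj hje
          by_cases hji : j ≤ t
          · rw [hval j hji]; exact hU _ (by omega) (by grind)
          · rw [hend j (by omega)]; exact hyU
        · intro j hj hjo
          have hji : j ≤ t := by rcases hjo with ⟨t, rfl⟩; omega
          rw [hval j hji]; exact hV _ (by omega) (by grind)
        · intro j hj
          have hji : j ≤ t := by omega
          rw [hval j hji]
          rcases hji.lt_or_eq with h | h
          · rw [hval (j + 1) h, Finset.pair_comm]
            convert hZedge (2 * k - (j + 1)) (by omega) using 5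
            omega
          · rw [hend (j + 1) (by omega)]
            have : 2 * k - j = i := by omega
            rw [this]; exact hZi
        · intro j hj
          by_cases hji : j ≤ t
          · rw [hval j hji]; exact hZv _ (by omega)
          · rw [hend j (by omega)]; exact hZy

/-! ### Sides of a component and covers of size less than two. -/

/-- The graph over `R` whose edges are the sets of size two that hit the clutter together with
`I`. -/
def pairGraph (C : Clutter α) (I R : Finset α) : SimpleGraph α where
  Adj x y := x ≠ y ∧ x ∈ R ∧ y ∈ R ∧ C.Hits (I ∪ {x, y})
  symm := ⟨fun x y h => ⟨h.1.symm, h.2.2.1, h.2.1, by rw [Finset.pair_comm]; exact h.2.2.2⟩⟩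
  loopless := ⟨fun _ h => h.1 rfl⟩

theorem IsClean.pairGraph_colorable {C : Clutter α} (hC : C.IsClean) {I R : Finset α}
    (hI : I ⊆ C.ground) (hR : ∀ x ∈ R, ¬ C.Hits (I ∪ {x})) : (C.pairGraph I R).Colorable 2 := by
  rw [SimpleGraph.two_colorable_iff_forall_loop_even]
  intro u w
  by_contra hodd
  rw [Nat.not_even_iff_odd] at hodd
  refine hC.no_odd_closed_walk hI hodd (p := w.getVert) (by simp) (fun i hi => ?_) fun i hi => ?_
  · exact hR _ (w.adj_getVert_succ hi).2.1
  · exact (w.adj_getVert_succ hi).2.2.2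

/-- If `U`, `V` are the two sides of a connected component, then deleting `U` and contracting `V`
leaves a clutter without covers of cardinality less than two. -/
theorem IsClean.two_le_card_of_hits {C : Clutter α} (hC : C.IsClean) {I R U V S : Finset α}
    (hI : I ⊆ C.ground) (hR : R ⊆ C.ground) (h0 : ¬ C.Hits I)
    (h1 : ∀ x ∈ R, ¬ C.Hits (I ∪ {x})) (hUR : U ⊆ R) (hVR : V ⊆ R) (hUV : Disjoint U V)
    (hIR : Disjoint I R)
    (hadj : ∀ x y, x ∈ U ∪ V → (C.pairGraph I R).Adj x y →
      (x ∈ U ∧ y ∈ V) ∨ (x ∈ V ∧ y ∈ U))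
    (hreach : ∀ x ∈ U, ∀ y ∈ U, (C.pairGraph I R).Reachable x y)
    (hSR : S ⊆ R) (hSUV : Disjoint S (U ∪ V)) (hS : C.Hits (I ∪ U ∪ S)) : 2 ≤ S.card := by
  by_contra hlt
  classical
  set W := I ∪ S with hW
  obtain ⟨D, hDmem, hDmin⟩ := Finset.exists_min_image
    ((U ∪ W).powerset.filter fun D => W ⊆ D ∧ C.Hits D) Finset.card
    ⟨U ∪ W, by simp only [Finset.mem_filter, Finset.mem_powerset]
               exact ⟨subset_rfl, Finset.subset_union_right, hS.mono (by grind)⟩⟩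
  simp only [Finset.mem_filter, Finset.mem_powerset] at hDmem hDmin
  obtain ⟨hDU, hWD, hD⟩ := hDmem
  have hWg : W ⊆ C.ground := Finset.union_subset hI (hSR.trans hR)
  have hDg : D ⊆ C.ground := hDU.trans (Finset.union_subset (hUR.trans hR) hWg)
  have hVD : Disjoint V D := by
    rw [Finset.disjoint_left] at *
    intro x hx hxD
    have h1 := hDU hxD
    have h2 := @hUV x
    have h3 := @hSUV x
    have h4 := @hIR x
    have h5 := @hVR x
    grind
  have hSle : S = ∅ ∨ ∃ s, S = {s} := by
    rcases Nat.le_one_iff_eq_zero_or_eq_one.1 (by omega : S.card ≤ 1) with h | h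
    · exact Or.inl (Finset.card_eq_zero.1 h)
    · exact Or.inr (Finset.card_eq_one.1 h)
  have hW0 : ¬ C.Hits W := by
    rcases hSle with rfl | ⟨s, rfl⟩
    · simpa [hW] using h0
    · exact h1 s (hSR (Finset.mem_singleton_self s))
  -- If `S = {s}` and `W ∪ {x}` were a cover, then `{x, s}` would be an edge leaving the component.
  have hW1 : ∀ x ∈ U ∪ V, ¬ C.Hits (W ∪ {x}) := by
    intro x hx hh
    have hxR : x ∈ R := Finset.union_subset hUR hVR hx
    rcases hSle with rfl | ⟨s, rfl⟩
    · exact h1 x hxR (by simpa [hW] using hh)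
    · have hs : s ∉ U ∪ V := Finset.disjoint_singleton_left.1 hSUV
      have hne : x ≠ s := fun h => hs (h ▸ hx)
      have := hadj x s hx ⟨hne, hxR, hSR (Finset.mem_singleton_self s), hh.mono (by grind)⟩
      grind
  -- Hence `D` has two elements in `U` beyond `W`, and the walk joining them inside the component is
  -- alternating and even.
  have hDW : 1 < (D \ W).card := by
    by_contra hle
    rcases Nat.le_one_iff_eq_zero_or_eq_one.1 (not_lt.1 hle) with h | h
    · exact hW0 (hD.mono (Finset.sdiff_eq_empty_iff_subset.1 (Finset.card_eq_zero.1 h)))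
    · obtain ⟨x, hx⟩ := Finset.card_eq_one.1 h
      have hxD : x ∈ D \ W := hx ▸ Finset.mem_singleton_self x
      refine hW1 x ?_ (hD.mono ?_)
      · have := hDU (Finset.mem_sdiff.1 hxD).1
        grind
      · rw [← hx]; grind
  obtain ⟨x, hx, y, hy, hxy⟩ := Finset.one_lt_card.1 hDW
  have hside : ∀ x ∈ D \ W, x ∈ U := by
    intro x hx
    have := hDU (Finset.mem_sdiff.1 hx).1
    grind
  obtain ⟨w⟩ := hreach x (hside x hx) y (hside y hy)
  have halt : ∀ i ≤ w.length, (Even i → w.getVert i ∈ U) ∧ (Odd i → w.getVert i ∈ V) := by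
    intro i
    induction i with
    | zero => intro _; simpa using hside x hx
    | succ i ih =>
      intro hi
      obtain ⟨ih1, ih2⟩ := ih (by omega)
      have hmem : w.getVert i ∈ U ∪ V := by
        rcases Nat.even_or_odd i with h | h
        · exact Finset.mem_union_left _ (ih1 h)
        · exact Finset.mem_union_right _ (ih2 h)
      have := hadj _ _ hmem (w.adj_getVert_succ (Nat.lt_of_succ_le hi))
      have hd := fun h : w.getVert i ∈ U => Finset.disjoint_left.1 hUV h
      grind
  have heven : Even w.length := by
    by_contra hodd
    have := (halt _ le_rfl).2 (Nat.not_even_iff_odd.1 hodd)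
    rw [w.getVert_length] at this
    exact Finset.disjoint_left.1 hUV (hside y hy) this
  obtain ⟨k, hk⟩ := heven
  have hk : w.length = 2 * k := by omega
  rw [hk] at halt
  have hend : w.getVert (2 * k) = y := by rw [← hk]; exact w.getVert_length
  refine hC.no_alternating_walk hDg (hVR.trans hR) hDU hVD hD
    (fun D' h1 h2 h3 => hDmin D' ⟨h2, h1, h3⟩) k W w.getVert subset_rfl hWD ?_ ?_ ?_
    (fun i hi => (halt i hi).1) (fun i hi => (halt i hi).2) ?_ ?_
  · simpa using hx
  · rw [hend]; exact hy
  · rw [hend]; simpa using hxy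
  · intro i hi
    exact (w.adj_getVert_succ (by omega)).2.2.2.mono
      (Finset.union_subset_union_left Finset.subset_union_left)
  · intro i hi
    refine hW1 _ ?_
    rcases Nat.even_or_odd i with h | h
    · exact Finset.mem_union_left _ ((halt i hi).1 h)
    · exact Finset.mem_union_right _ ((halt i hi).2 h)


/-! ### Fractional packings of value two in minors. -/

/-- A fractional packing of value two by members disjoint from `I`, where the elements of `J` may be
used without restriction. -/
structure IsMinorPacking (C : Clutter α) (I J : Finset α) (y : Finset α → ℝ) : Prop where
  nonneg : ∀ A, 0 ≤ y A
  eq_zero : ∀ A, ¬ Disjoint A I → y A = 0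
  value : ∑ A ∈ C.members, y A = 2
  load_le : ∀ v ∈ C.ground \ (I ∪ J), ∑ A ∈ C.members.filter (fun A => v ∈ A), y A ≤ 1

theorem IsMinorPacking.load_eq_zero {C : Clutter α} {I J : Finset α} {y : Finset α → ℝ}
    (h : C.IsMinorPacking I J y) {v : α} (hv : v ∈ I) :
    ∑ A ∈ C.members.filter (fun A => v ∈ A), y A = 0 :=
  Finset.sum_eq_zero fun A hA => h.eq_zero A
    (Finset.not_disjoint_iff.2 ⟨v, (Finset.mem_filter.1 hA).2, hv⟩)

theorem IsMinorPacking.load_le_two {C : Clutter α} {I J : Finset α} {y : Finset α → ℝ}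
    (h : C.IsMinorPacking I J y) (v : α) :
    ∑ A ∈ C.members.filter (fun A => v ∈ A), y A ≤ 2 := by
  rw [← h.value]
  exact Finset.sum_le_sum_of_subset_of_nonneg (Finset.filter_subset _ _) fun A _ _ => h.nonneg A

/-- Induction on the number of remaining elements. Pick a component with sides `U`, `V`, take
packings for the two smaller minors that delete one side and contract the other, and average them.
On the component one load is zero and the other at most two; elsewhere both are at most one. -/
theorem IsClean.exists_isMinorPacking {C : Clutter α} (hC : C.IsClean) (n : ℕ) :
    ∀ I J : Finset α, I ⊆ C.ground → (C.ground \ (I ∪ J)).card = n →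
      (∀ S ⊆ C.ground \ (I ∪ J), C.Hits (I ∪ S) → 2 ≤ S.card) → ∃ y, C.IsMinorPacking I J y := by
  induction n using Nat.strong_induction_on with
  | _ n ih =>
  intro I J hI hn hcov
  set R := C.ground \ (I ∪ J) with hR
  have h0 : ¬ C.Hits I := fun h => by simpa using hcov ∅ (Finset.empty_subset _) (by simpa using h)
  have h1 : ∀ x ∈ R, ¬ C.Hits (I ∪ {x}) := fun x hx h => by
    simpa using hcov {x} (Finset.singleton_subset_iff.2 hx) h
  have hRg : R ⊆ C.ground := Finset.sdiff_subset
  have hIR : Disjoint I R := by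
    rw [Finset.disjoint_left]
    grind
  rcases R.eq_empty_or_nonempty with hR0 | ⟨x0, hx0⟩
  · obtain ⟨A, hA, hAI⟩ := not_hits.1 h0
    refine ⟨fun B => if B = A then 2 else 0, ⟨fun B => ?_, fun B hB => ?_, ?_, ?_⟩⟩
    · split_ifs <;> norm_num
    · exact if_neg (by rintro rfl; exact hB hAI)
    · simp [hA]
    · rw [← hR, hR0]; simp
  · classical
    obtain ⟨c⟩ := hC.pairGraph_colorable hI h1
    set G := C.pairGraph I R with hG
    set U := R.filter fun x => G.Reachable x0 x ∧ c x = 0 with hU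
    set V := R.filter fun x => G.Reachable x0 x ∧ c x = 1 with hV
    have hUR : U ⊆ R := Finset.filter_subset _ _
    have hVR : V ⊆ R := Finset.filter_subset _ _
    have hUV : Disjoint U V := by
      rw [Finset.disjoint_left]
      intro x hx hx'
      have h1 := (Finset.mem_filter.1 hx).2.2
      rw [(Finset.mem_filter.1 hx').2.2] at h1
      exact absurd h1 (by decide)
    have hmem : ∀ x ∈ R, G.Reachable x0 x → (x ∈ U ∧ c x = 0) ∨ (x ∈ V ∧ c x = 1) := by
      intro x hx hr
      have : c x = 0 ∨ c x = 1 := by omega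
      rcases this with h | h
      · exact Or.inl ⟨Finset.mem_filter.2 ⟨hx, hr, h⟩, h⟩
      · exact Or.inr ⟨Finset.mem_filter.2 ⟨hx, hr, h⟩, h⟩
    have hreach : ∀ x ∈ U ∪ V, G.Reachable x0 x := by
      intro x hx
      rcases Finset.mem_union.1 hx with h | h <;> exact (Finset.mem_filter.1 h).2.1
    have hadj : ∀ x y, x ∈ U ∪ V → G.Adj x y → (x ∈ U ∧ y ∈ V) ∨ (x ∈ V ∧ y ∈ U) := by
      intro x y hx hxy
      have hne := c.valid hxy
      have hr := hreach x hx
      rcases hmem x hxy.2.1 hr with ⟨h1, h2⟩ | ⟨h1, h2⟩ <;>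
      rcases hmem y hxy.2.2.1 (hr.trans hxy.reachable) with ⟨h3, h4⟩ | ⟨h3, h4⟩
      · exact absurd (h2.trans h4.symm) hne
      · exact Or.inl ⟨h1, h3⟩
      · exact Or.inr ⟨h1, h3⟩
      · exact absurd (h2.trans h4.symm) hne
    have hx0UV : x0 ∈ U ∪ V := by
      rcases hmem x0 hx0 (SimpleGraph.Reachable.refl x0) with h | h
      · exact Finset.mem_union_left _ h.1
      · exact Finset.mem_union_right _ h.1
    have step : ∀ X Y : Finset α, X ⊆ R → X ∪ Y = U ∪ V →
        (∀ S ⊆ R, Disjoint S (U ∪ V) → C.Hits (I ∪ X ∪ S) → 2 ≤ S.card) →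
        ∃ y, C.IsMinorPacking (I ∪ X) (J ∪ Y) y := by
      intro X Y hX hXY hS
      have hrest : C.ground \ (I ∪ X ∪ (J ∪ Y)) = R \ (U ∪ V) := by
        rw [← hXY, hR, sdiff_sdiff, Finset.sup_eq_union, Finset.union_union_union_comm]
      refine ih _ ?_ (I ∪ X) (J ∪ Y) (Finset.union_subset hI (hX.trans hRg)) rfl ?_
      · rw [hrest, ← hn]
        exact Finset.card_lt_card (Finset.ssubset_iff_of_subset Finset.sdiff_subset |>.2
          ⟨x0, hx0, fun h => (Finset.mem_sdiff.1 h).2 hx0UV⟩)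
      · rw [hrest]
        exact fun S hSR => hS S (hSR.trans Finset.sdiff_subset)
          (Finset.disjoint_of_subset_left hSR Finset.sdiff_disjoint)
    obtain ⟨y, hy⟩ := step U V hUR rfl fun S hSR hSd hS =>
      hC.two_le_card_of_hits hI hRg h0 h1 hUR hVR hUV hIR hadj
        (fun a ha b hb => (hreach a (Finset.mem_union_left _ ha)).symm.trans
          (hreach b (Finset.mem_union_left _ hb))) hSR hSd hS
    obtain ⟨z, hz⟩ := step V U hVR (Finset.union_comm V U) fun S hSR hSd hS =>
      hC.two_le_card_of_hits hI hRg h0 h1 hVR hUR hUV.symm hIR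
        (fun a b ha hab => (hadj a b (by rwa [Finset.union_comm]) hab).symm)
        (fun a ha b hb => (hreach a (Finset.mem_union_right _ ha)).symm.trans
          (hreach b (Finset.mem_union_right _ hb))) hSR (by rwa [Finset.union_comm]) hS
    have hsum : ∀ F : Finset (Finset α), ∑ A ∈ F, (y A + z A) / 2 =
        (∑ A ∈ F, y A + ∑ A ∈ F, z A) / 2 := by
      intro F
      rw [← Finset.sum_div, Finset.sum_add_distrib]
    refine ⟨fun A => (y A + z A) / 2, ⟨fun A => ?_, fun A hA => ?_, ?_, fun v hv => ?_⟩⟩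
    · have := hy.nonneg A
      have := hz.nonneg A
      positivity
    · have hsub : ∀ X, ¬ Disjoint A (I ∪ X) := fun X h => hA (h.mono_right Finset.subset_union_left)
      change (y A + z A) / 2 = 0
      rw [hy.eq_zero A (hsub U), hz.eq_zero A (hsub V)]
      norm_num
    · rw [hsum, hy.value, hz.value]; norm_num
    · rw [hsum]
      by_cases hvU : v ∈ U
      · have := hy.load_eq_zero (Finset.mem_union_right I hvU)
        have := hz.load_le_two v
        linarith
      by_cases hvV : v ∈ V
      · have := hz.load_eq_zero (Finset.mem_union_right I hvV)
        have := hy.load_le_two v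
        linarith
      · have hv' : v ∈ C.ground ∧ ¬ (v ∈ I ∨ v ∈ J) := by simpa [hR] using hv
        have := hy.load_le v (by simp only [Finset.mem_sdiff, Finset.mem_union]; tauto)
        have := hz.load_le v (by simp only [Finset.mem_sdiff, Finset.mem_union]; tauto)
        linarith

/-! ### Tangled clutters and bipartitions of components. -/

theorem IsTangled.two_le_card {C : Clutter α} (hT : C.IsTangled) {S : Finset α} (hS : C.Hits S) :
    2 ≤ S.card := by
  have hcov : C.IsCover (S ∩ C.ground) := by
    refine ⟨Finset.inter_subset_right, fun A hA => ?_⟩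
    obtain ⟨x, hx⟩ := hS A hA
    obtain ⟨h1, h2⟩ := Finset.mem_inter.1 hx
    exact ⟨x, by simp [h1, h2, C.subset_ground A hA h1]⟩
  have h1 : C.coveringNumber ≤ ((S ∩ C.ground).card : ℕ∞) := iInf₂_le _ hcov
  rw [hT.1] at h1
  exact (Nat.cast_le.1 h1 : 2 ≤ _).trans (Finset.card_le_card Finset.inter_subset_left)

theorem IsTangled.isMinimumCover_iff {C : Clutter α} (hT : C.IsTangled) {S : Finset α} :
    C.IsMinimumCover S ↔ C.IsCover S ∧ S.card = 2 := by
  constructor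
  · rintro ⟨hS, hmin⟩
    refine ⟨hS, le_antisymm ?_ (hT.two_le_card hS.2)⟩
    have : (S.card : ℕ∞) ≤ C.coveringNumber :=
      le_iInf₂ fun B hB => Nat.cast_le.2 (hmin B hB)
    rw [hT.1] at this
    exact Nat.cast_le.1 this
  · rintro ⟨hS, hcard⟩
    exact ⟨hS, fun B hB => hcard.trans_le (hT.two_le_card hB.2)⟩

theorem IsTangled.graph_adj_iff {C : Clutter α} (hT : C.IsTangled)
    (u v : {v : α // v ∈ C.ground}) :
    C.graph.Adj u v ↔ (C.pairGraph ∅ C.ground).Adj u.1 v.1 := by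
  change (u ≠ v ∧ C.IsMinimumCover {u.1, v.1}) ↔
    (u.1 ≠ v.1 ∧ u.1 ∈ C.ground ∧ v.1 ∈ C.ground ∧ C.Hits (∅ ∪ {u.1, v.1}))
  rw [hT.isMinimumCover_iff, Finset.empty_union, ne_eq, Subtype.ext_iff]
  constructor
  · rintro ⟨hne, hc, -⟩
    exact ⟨hne, u.2, v.2, hc.2⟩
  · rintro ⟨hne, hu, hv, hh⟩
    exact ⟨hne, ⟨Finset.insert_subset hu (Finset.singleton_subset_iff.2 hv), hh⟩,
      Finset.card_pair hne⟩

theorem IsTangled.not_hits_singleton {C : Clutter α} (hT : C.IsTangled) (x : α) :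
    ¬ C.Hits (∅ ∪ {x}) := fun h => by simpa using hT.two_le_card h

theorem IsBipartitionOf.swap {C : Clutter α} {K : C.graph.ConnectedComponent} {U V : Finset α}
    (h : C.IsBipartitionOf K U V) : C.IsBipartitionOf K V U where
  disjoint := h.disjoint.symm
  union_eq := by rw [Finset.union_comm]; exact h.union_eq
  adj u v hu huv := (h.adj u v hu huv).symm

theorem IsBipartitionOf.mem_union_iff {C : Clutter α} {K : C.graph.ConnectedComponent}
    {U V : Finset α} (h : C.IsBipartitionOf K U V) {x : α} :
    x ∈ U ∪ V ↔ ∃ hx : x ∈ C.ground, (⟨x, hx⟩ : {v : α // v ∈ C.ground}) ∈ K.supp := by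
  rw [← Finset.mem_coe, h.union_eq]
  simp

theorem IsClean.exists_isBipartitionOf {C : Clutter α} (hC : C.IsClean) (hT : C.IsTangled)
    (K : C.graph.ConnectedComponent) : ∃ U V : Finset α, C.IsBipartitionOf K U V := by
  classical
  obtain ⟨c⟩ := hC.pairGraph_colorable (R := C.ground) (Finset.empty_subset _)
    fun x _ => hT.not_hits_singleton x
  have hc : ∀ x, c x = 0 ∨ c x = 1 := by omega
  refine ⟨C.ground.filter fun x => (∃ hx, (⟨x, hx⟩ : {v : α // v ∈ C.ground}) ∈ K.supp) ∧ c x = 0,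
    C.ground.filter fun x => (∃ hx, (⟨x, hx⟩ : {v : α // v ∈ C.ground}) ∈ K.supp) ∧ c x = 1,
    ?_, ?_, ?_⟩
  · rw [Finset.disjoint_left]
    intro x hx hx'
    have h1 := (Finset.mem_filter.1 hx).2.2
    rw [(Finset.mem_filter.1 hx').2.2] at h1
    exact absurd h1 (by decide)
  · ext x
    simp only [Finset.coe_union, Finset.coe_filter, Set.mem_union, Set.mem_ofPred_eq, Set.mem_image,
      Subtype.exists, exists_and_right, exists_eq_right]
    have := hc x
    tauto
  · intro u v hu huv
    have hv : v ∈ K.supp := (K.mem_supp_congr_adj huv).1 hu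
    have hne := c.valid ((hT.graph_adj_iff u v).1 huv)
    have h1 := hc u.1
    have h2 := hc v.1
    have hu' : ∃ hx, (⟨u.1, hx⟩ : {v : α // v ∈ C.ground}) ∈ K.supp := ⟨u.2, hu⟩
    have hv' : ∃ hx, (⟨v.1, hx⟩ : {v : α // v ∈ C.ground}) ∈ K.supp := ⟨v.2, hv⟩
    simp only [Finset.mem_filter, u.2, v.2, true_and]
    rcases h1 with h1 | h1 <;> rcases h2 with h2 | h2 <;> simp_all

theorem IsClean.exists_isMinorPacking_of_isBipartitionOf {C : Clutter α} (hC : C.IsClean)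
    (hT : C.IsTangled) {K : C.graph.ConnectedComponent} {U V : Finset α}
    (h : C.IsBipartitionOf K U V) : ∃ y, C.IsMinorPacking U V y := by
  have hg : U ∪ V ⊆ C.ground := fun x hx => (h.mem_union_iff.1 hx).1
  have hUg : U ⊆ C.ground := Finset.subset_union_left.trans hg
  have hVg : V ⊆ C.ground := Finset.subset_union_right.trans hg
  let f : C.graph →g C.pairGraph ∅ C.ground := ⟨Subtype.val, (hT.graph_adj_iff _ _).1⟩
  refine hC.exists_isMinorPacking _ U V hUg rfl fun S hS hh => ?_
  refine hC.two_le_card_of_hits (I := ∅) (R := C.ground) (U := U) (V := V) (Finset.empty_subset _)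
    subset_rfl (fun hh => by simpa using hT.two_le_card hh)
    (fun x _ => hT.not_hits_singleton x) hUg hVg h.disjoint (Finset.disjoint_empty_left _) ?_ ?_
    (hS.trans Finset.sdiff_subset) (Finset.disjoint_of_subset_left hS Finset.sdiff_disjoint)
    (by simpa using hh)
  · intro x y hx hxy
    obtain ⟨hxg, hxK⟩ := h.mem_union_iff.1 hx
    exact h.adj ⟨x, hxg⟩ ⟨y, hxy.2.2.1⟩ hxK ((hT.graph_adj_iff _ _).2 hxy)
  · intro x hx y hy
    obtain ⟨hxg, hxK⟩ := h.mem_union_iff.1 (Finset.mem_union_left V hx)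
    obtain ⟨hyg, hyK⟩ := h.mem_union_iff.1 (Finset.mem_union_left V hy)
    have : C.graph.Reachable ⟨x, hxg⟩ ⟨y, hyg⟩ :=
      SimpleGraph.ConnectedComponent.exact (hxK.trans hyK.symm)
    exact this.map f

/-! ### The two inclusions for the core. -/

/-- A member of positive weight in a fractional packing of value two contains exactly one element
of every cover of cardinality two. -/
theorem mem_iff_notMem_of_packing {C : Clutter α} {y : Finset α → ℝ}
    (hy : C.IsFractionalPacking y) (hval : C.packingValue y = 2) {A : Finset α}
    (hA : A ∈ C.members) (hpos : 0 < y A) {a b : α} (ha : a ∈ C.ground) (hb : b ∈ C.ground)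
    (hab : C.Hits {a, b}) : a ∈ A ↔ b ∉ A := by
  have hla := hy.2 a ha
  have hlb := hy.2 b hb
  rw [Finset.sum_filter] at hla hlb
  -- These terms are nonnegative and sum to the two loads minus two, hence to at most zero; a member
  -- containing both ends would contribute its full weight.
  have hterm : ∀ B ∈ C.members,
      0 ≤ (if a ∈ B then y B else 0) + (if b ∈ B then y B else 0) - y B := by
    intro B hB
    have h0 := hy.1 B hB
    obtain ⟨x, hx⟩ := hab B hB
    have : a ∈ B ∨ b ∈ B := by grind
    split_ifs <;> first | linarith | tauto
  have hle := Finset.single_le_sum hterm hA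
  rw [Finset.sum_sub_distrib, Finset.sum_add_distrib] at hle
  unfold packingValue at hval
  obtain ⟨x, hx⟩ := hab A hA
  have : a ∈ A ∨ b ∈ A := by grind
  by_cases h1 : a ∈ A <;> by_cases h2 : b ∈ A
  · simp only [h1, h2, if_true] at hle
    linarith
  all_goals tauto

theorem IsBipartitionOf.inter_eq {C : Clutter α} (hT : C.IsTangled)
    {K : C.graph.ConnectedComponent} {U V : Finset α} (h : C.IsBipartitionOf K U V) {A : Finset α}
    (hA : ∀ a ∈ C.ground, ∀ b ∈ C.ground, C.Hits {a, b} → (a ∈ A ↔ b ∉ A)) :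
    A ∩ (U ∪ V) = U ∨ A ∩ (U ∪ V) = V := by
  have hdisj : ∀ x, x ∈ U → x ∉ V := fun x hx => Finset.disjoint_left.1 h.disjoint hx
  -- Along an edge, membership in `A` and membership in `U` both flip, so their agreement is
  -- constant on the component.
  have hwalk : ∀ u v, C.graph.Walk u v → u ∈ K.supp →
      ((u.1 ∈ A ↔ u.1 ∈ U) ↔ (v.1 ∈ A ↔ v.1 ∈ U)) := by
    intro u v w
    induction w with
    | nil => intro _; rfl
    | @cons u v w huv _ ih =>
      intro hu
      rw [← ih ((K.mem_supp_congr_adj huv).1 hu)]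
      have h1 := hA u.1 u.2 v.1 v.2 (by
        have := ((hT.graph_adj_iff u v).1 huv).2.2.2
        rwa [Finset.empty_union] at this)
      have h2 := h.adj u v hu huv
      have h3 := hdisj u.1
      have h4 := hdisj v.1
      tauto
  obtain ⟨u, hu⟩ := K.nonempty_supp
  have hall : ∀ x ∈ U ∪ V, ((u.1 ∈ A ↔ u.1 ∈ U) ↔ (x ∈ A ↔ x ∈ U)) := by
    intro x hx
    obtain ⟨hxg, hxK⟩ := h.mem_union_iff.1 hx
    obtain ⟨w⟩ : C.graph.Reachable u ⟨x, hxg⟩ :=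
      SimpleGraph.ConnectedComponent.exact (hu.trans hxK.symm)
    exact hwalk _ _ w hu
  by_cases hP : u.1 ∈ A ↔ u.1 ∈ U
  · left
    ext x
    have h1 := hall x
    have h2 := hdisj x
    simp only [Finset.mem_inter, Finset.mem_union] at h1 ⊢
    tauto
  · right
    ext x
    have h1 := hall x
    have h2 := hdisj x
    simp only [Finset.mem_inter, Finset.mem_union] at h1 ⊢
    tauto

theorem IsClean.exists_packing_pos {C : Clutter α} (hC : C.IsClean) (hT : C.IsTangled)
    {r : ℕ} {K : Fin r → C.graph.ConnectedComponent} (hK : Function.Bijective K)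
    {U V : Fin r → Finset α} (hUV : ∀ i, C.IsBipartitionOf (K i) (U i) (V i)) {A : Finset α}
    (hA : A ∈ C.members) (hAUV : ∀ i, A ∩ (U i ∪ V i) = U i ∨ A ∩ (U i ∪ V i) = V i) :
    ∃ y, C.IsFractionalPacking y ∧ C.packingValue y = 2 ∧ 0 < y A := by
  have hex : ∀ i, ∃ y X Y, C.IsMinorPacking X Y y ∧ X = A ∩ (U i ∪ V i) ∧ X ∪ Y = U i ∪ V i := by
    intro i
    rcases hAUV i with h | h
    · obtain ⟨y, hy⟩ := hC.exists_isMinorPacking_of_isBipartitionOf hT (hUV i)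
      exact ⟨y, U i, V i, hy, h.symm, rfl⟩
    · obtain ⟨y, hy⟩ := hC.exists_isMinorPacking_of_isBipartitionOf hT (hUV i).swap
      exact ⟨y, V i, U i, hy, h.symm, Finset.union_comm _ _⟩
  choose y X Y hy hX hXY using hex
  have hr : (0 : ℝ) < 2 / (r + 1) := by positivity
  have hsum : ∀ F : Finset (Finset α),
      ∑ B ∈ F, 2 / ((r : ℝ) + 1) * ((if B = A then 1 else 0) + (∑ i, y i B) / 2) =
        2 / ((r : ℝ) + 1) * ((if A ∈ F then 1 else 0) + (∑ i, ∑ B ∈ F, y i B) / 2) := by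
    intro F
    rw [← Finset.mul_sum, Finset.sum_add_distrib, ← Finset.sum_div, Finset.sum_comm,
      Finset.sum_ite_eq' F A]
  -- Each `y i / 2` has value one, so with the unit weight on `A` the total before scaling is `r +
  -- 1`. At `v` in component `j` the load before scaling is at most `1 + (r - 1) / 2` if `v ∈ A`,
  -- where `y j` vanishes, and at most `(r - 1 + 2) / 2` otherwise; both equal `(r + 1) / 2`.
  refine ⟨fun B => 2 / ((r : ℝ) + 1) * ((if B = A then 1 else 0) + (∑ i, y i B) / 2),
    ⟨fun B _ => ?_, fun v hv => ?_⟩, ?_, ?_⟩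
  · have : 0 ≤ ∑ i, y i B := Finset.sum_nonneg fun i _ => (hy i).nonneg B
    refine mul_nonneg hr.le ?_
    split_ifs <;> linarith
  · rw [hsum]
    obtain ⟨j, hj⟩ := hK.2 (C.graph.connectedComponentMk ⟨v, hv⟩)
    have hvj : v ∈ U j ∪ V j := (hUV j).mem_union_iff.2 ⟨hv, by rw [hj]; rfl⟩
    have hother : ∀ i, i ≠ j → v ∉ U i ∪ V i := by
      intro i hij hvi
      obtain ⟨_, hvK⟩ := (hUV i).mem_union_iff.1 hvi
      exact hij (hK.1 (hvK.symm.trans hj.symm))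
    have hload : ∀ t : ℝ, ∑ B ∈ C.members.filter (fun B => v ∈ B), y j B ≤ t →
        ∑ i, ∑ B ∈ C.members.filter (fun B => v ∈ B), y i B ≤ r + (t - 1) := by
      intro t ht
      have hterm : ∀ i ∈ Finset.univ, ∑ B ∈ C.members.filter (fun B => v ∈ B), y i B ≤
          1 + if i = j then t - 1 else 0 := by
        intro i _
        by_cases hij : i = j
        · subst hij; simpa using ht
        · have := (hy i).load_le v (Finset.mem_sdiff.2 ⟨hv, by rw [hXY]; exact hother i hij⟩)
          simpa [hij] using this
      refine (Finset.sum_le_sum hterm).trans (le_of_eq ?_)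
      simp [Finset.sum_add_distrib]
    rw [div_mul_eq_mul_div, div_le_one (by positivity)]
    by_cases hvA : v ∈ A
    · have h1 := hload 0 ((hy j).load_eq_zero (by rw [hX]; exact Finset.mem_inter.2 ⟨hvA, hvj⟩)).le
      simp only [Finset.mem_filter, hA, hvA, and_self, if_true]
      linarith
    · have h1 := hload 2 ((hy j).load_le_two v)
      simp only [Finset.mem_filter, hvA, and_false, if_false]
      linarith
  · unfold packingValue
    rw [hsum]
    simp only [hA, if_true, (hy _).value, Finset.sum_const, Finset.card_univ, Fintype.card_fin,
      nsmul_eq_mul]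
    field_simp
    ring
  · have : 0 ≤ ∑ i, y i A := Finset.sum_nonneg fun i _ => (hy i).nonneg A
    simp only [if_true]
    positivity

end Clutter

theorem mainTheorem6 {α : Type*} [DecidableEq α] (C : Clutter α)
    (hclean : C.IsClean) (htangled : C.IsTangled) :
    (∀ K : C.graph.ConnectedComponent, ∃ U V : Finset α, C.IsBipartitionOf K U V) ∧
    ∀ (K : Fin C.rank ≃ C.graph.ConnectedComponent) (U V : Fin C.rank → Finset α),
      (∀ i, C.IsBipartitionOf (K i) (U i) (V i)) →
      (C.core.members : Set (Finset α)) =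
        {A | A ∈ C.members ∧ ∀ i, A ∩ (U i ∪ V i) = U i ∨ A ∩ (U i ∪ V i) = V i} := by
  refine ⟨hclean.exists_isBipartitionOf htangled, fun K U V hUV => ?_⟩
  ext A
  simp only [Clutter.core, Finset.coe_filter, Set.mem_ofPred_eq]
  refine and_congr_right fun hA => ⟨?_, hclean.exists_packing_pos htangled K.bijective hUV hA⟩
  rintro ⟨y, hy, hval, hpos⟩ i
  exact (hUV i).inter_eq htangled fun a ha b hb hab =>
    Clutter.mem_iff_notMem_of_packing hy hval hA hpos ha hb hab
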